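/- **Theorem 2.** Let $G$ be a finite connected graph (loops and multiple edges allowed), cellularly embedded in the closed orientable surface $S_g$ of genus $g\ge 0$ (every face is an open disc), and let $T$ be a spanning tree of $G$. For an edge $e\in E(G)\setminus E(T)$, the fundamental cycle $C_T(e)$ is the unique cycle of $T+e$. A cycle $C$ of $G$ is called contractible if some component of $S_g\setminus C$ is an open disc, and noncontractible otherwise. Then there are $2g$ distinct noncontractible fundamental cycles $C_1,C_2,\dots,C_{2g}$ of $G$ with respect to $T$ (so there are at least $2g$ noncontractible ones) such that, for every $1\le i\le g$, the cycles $C_{2i-1}$ and $C_{2i}$ have a vertex in common. In particular, if the embedding has exactly one face, then for any spanning tree $T$ of $G$ there are $2g$ distinct edges $e_1,\dots,e_{2g}$ in $E(G)\setminus E(T)$ whose fundamental cycles $C_j=C_T(e_j)$ satisfy $C_{2i-1}\cap C_{2i}\neq\emptyset$ for $1\le i\le g$. -/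

import Mathlib

open scoped Graph

/-! ### Connected multigraphs, cycles, spanning trees, fundamental cycles

Loops and multiple edges are allowed throughout. -/

namespace Graph

variable {α β : Type*}

/-- `G` is connected: it has a vertex, and any two vertices are joined by a walk. -/
def IsConnectedGraph (G : Graph α β) : Prop :=
  V(G).Nonempty ∧ ∀ x ∈ V(G), ∀ y ∈ V(G), Relation.ReflTransGen G.Adj x y

/-- `C` is a cycle of length `n ≥ 1`: its distinct vertices `v 0, …, v (n-1)` and distinct edges
`e 0, …, e (n-1)` are such that `e i` joins `v i` and `v (i+1)`, with indices modulo `n`.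
A loop is a cycle of length one, and two parallel edges form a cycle of length two. -/
def IsCycleGraph (C : Graph α β) : Prop :=
  ∃ (n : ℕ) (_ : NeZero n) (v : Fin n → α) (e : Fin n → β),
    Function.Injective v ∧ Function.Injective e ∧
    V(C) = Set.range v ∧ E(C) = Set.range e ∧
    ∀ i, C.IsLink (e i) (v i) (v (i + 1))

/-- A tree: connected and without cycles. -/
def IsTreeGraph (T : Graph α β) : Prop :=
  T.IsConnectedGraph ∧ ∀ C : Graph α β, C ≤ T → ¬ C.IsCycleGraph

/-- `T` is a spanning tree of `G`. -/
def IsSpanningTree (T G : Graph α β) : Prop :=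
  T.IsSpanningSubgraph G ∧ T.IsTreeGraph

/-- `C` is the fundamental cycle `C_T(e)` of `G` given by the edge `e` outside `T`: the cycle
contained in `T + e`. -/
def IsFundamentalCycle (G T : Graph α β) (e : β) (C : Graph α β) : Prop :=
  e ∈ E(G) \ E(T) ∧ C ≤ G ∧ C.IsCycleGraph ∧ e ∈ E(C) ∧ E(C) ⊆ insert e E(T)

end Graph

/-! ### Cellular embeddings in oriented closed surfaces -/

/-- A cellular embedding of the graph `G` in an oriented closed surface, given by its rotation
system. Every edge has two darts (half-edges), interchanged by `rev`; the dart `d` belongs to the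
edge `edge d` and points away from the vertex `vert d`. The permutation `next` sends a dart to the
one that follows it in the cyclic order, given by the orientation, of the darts around its
vertex. The surface is obtained by gluing an open disc along every facial walk. -/
structure OrientedEmbedding {α β : Type*} (G : Graph α β) (D : Type*) where
  /-- The underlying edge of a dart. -/
  edge : D → β
  /-- The vertex that a dart points away from. -/
  vert : D → α
  /-- The opposite dart of the same edge. -/
  rev : Equiv.Perm D
  /-- The next dart in the rotation around the vertex. -/
  next : Equiv.Perm D
  rev_rev : ∀ d, rev (rev d) = d
  rev_ne : ∀ d, rev d ≠ d
  isLink : ∀ d, G.IsLink (edge d) (vert d) (vert (rev d))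
  edge_surj : ∀ e ∈ E(G), ∃ d, edge d = e
  edge_eq_iff : ∀ d d', edge d = edge d' ↔ d' = d ∨ d' = rev d
  vert_eq_iff : ∀ d d', vert d = vert d' ↔ next.SameCycle d d'

/-- The cells of a cell decomposition of a surface: vertices, (open) edges, (open) faces. -/
inductive SurfaceCell (α β φ : Type*) where
  | vertex (v : α)
  | edge (e : β)
  | face (f : φ)

namespace OrientedEmbedding

variable {α β D : Type*} {G : Graph α β} (M : OrientedEmbedding G D)

/-- Facial walks are traced by going along a dart to its other end and leaving that vertex by the
dart which follows, in the rotation, the one of arrival. -/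
def facePerm : Equiv.Perm D := M.next * M.rev

/-- The faces: the facial walks (the orbits of `facePerm`), and, at a vertex without edges, one
face with a trivial facial walk (this occurs, for a connected graph, only for a single vertex
without edges in the sphere). -/
def Face : Type _ :=
  Quotient (Equiv.Perm.SameCycle.setoid M.facePerm) ⊕ {v : α // v ∈ V(G) ∧ ∀ d, M.vert d ≠ v}

/-- The face whose facial walk runs through the dart `d`. It contains the corner between `d` and
the preceding dart at the vertex of `d`. -/
def faceOf (d : D) : M.Face := Sum.inl (Quotient.mk _ d)

/-- The surface of the embedding of the connected graph `G` has genus `g`, i.e. it is `S_g`: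
its Euler characteristic `|V| - |E| + |F|` is `2 - 2g`. -/
def HasGenus (g : ℕ) : Prop :=
  (V(G).ncard : ℤ) - (E(G).ncard : ℤ) + (Nat.card M.Face : ℤ) = 2 - 2 * (g : ℤ)

/-- The type of cells. Only the vertices and edges that belong to `G` are cells of the surface. -/
abbrev Cell : Type _ := SurfaceCell α β M.Face

/-- The cell `a` is contained in the frontier of the cell `b`. -/
def InFrontier : M.Cell → M.Cell → Prop
  | .vertex v, .edge e => G.Inc e v
  | .vertex v, .face f => (∃ d, M.vert d = v ∧ M.faceOf d = f) ∨ ∃ h, f = Sum.inr ⟨v, h⟩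
  | .edge e, .face f => ∃ d, M.edge d = e ∧ M.faceOf d = f
  | _, _ => False

/-- The cells that make up the complement of the subgraph `C` in the surface. -/
def complement (C : Graph α β) : Set M.Cell :=
  {c | match c with
    | .vertex v => v ∈ V(G) ∧ v ∉ V(C)
    | .edge e => e ∈ E(G) ∧ e ∉ E(C)
    | .face _ => True}

/-- Two cells of the complement of `C` lie in the same connected component of that complement. -/
def ConnectedOff (C : Graph α β) : M.Cell → M.Cell → Prop :=
  Relation.EqvGen fun a b => a ∈ M.complement C ∧ b ∈ M.complement C ∧ M.InFrontier a b

/-- `K` is (the set of cells of) a connected component of the surface minus `C`. -/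
def IsComponentOff (C : Graph α β) (K : Set M.Cell) : Prop :=
  ∃ a ∈ M.complement C, K = {b | M.ConnectedOff C a b}

/-- The Euler characteristic of a set of cells. -/
noncomputable def eulerChar (K : Set M.Cell) : ℤ :=
  ({v : α | SurfaceCell.vertex v ∈ K}.ncard : ℤ) - ({e : β | SurfaceCell.edge e ∈ K}.ncard : ℤ)
    + ({f : M.Face | SurfaceCell.face f ∈ K}.ncard : ℤ)

/-- The cycle `C` is contractible: some component of the surface minus `C` is an open disc.
Such a component is the interior of a compact connected orientable surface with `b ≥ 1` boundary
circles and some genus `h`, so its Euler characteristic is `2 - 2h - b`; hence it is an open disc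
if and only if its Euler characteristic is `1`. -/
def IsContractible (C : Graph α β) : Prop :=
  ∃ K, M.IsComponentOff C K ∧ M.eulerChar K = 1

end OrientedEmbedding

/-! The argument is homology modulo two. A cycle `z` has a potential `c` on the corners, jumping by
`z` at each dart; comparing `c` on the two sides of every edge gives the Poincaré dual cochain, and
pairing it with another cycle gives the intersection form. This form is symmetric and alternating,
vanishes when one cycle bounds a set of faces, and vanishes on vertex-disjoint cycles.

Let `A` be its matrix on the fundamental cycles of `T`. A combination in the kernel has a dual
cochain orthogonal to all fundamental cycles; this cochain is a coboundary, so the combination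
bounds faces. Boundaries have dimension at most `|F| - 1`, and there are at least `|E| - |V| + 1`
fundamental cycles, hence `A` has rank at least `2g` by Euler's formula.

An alternating matrix of rank `r` over a field of characteristic two has a nonsingular principal `r
× r` submatrix, and the determinant of the latter has a nonzero term from a fixed point free
involution. Its transpositions pair up cycles that intersect oddly. Such cycles share a vertex, and
neither is contractible, because a contractible cycle bounds faces. -/

theorem Fin.two_mul_lt {g : ℕ} (i : Fin g) : 2 * (i : ℕ) < 2 * g := by omega

theorem Fin.two_mul_add_one_lt {g : ℕ} (i : Fin g) : 2 * (i : ℕ) + 1 < 2 * g := by omega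

/-! ### Alternating matrices in characteristic two -/

open Finset in
/-- In characteristic two, the terms of the determinant of a symmetric matrix cancel in pairs
except for those of the involutions. -/
theorem Matrix.exists_fixedPointFree_involution {n R : Type*} [Fintype n] [DecidableEq n]
    [CommRing R] [CharP R 2] (A : Matrix n n R) (hs : ∀ i j, A i j = A j i)
    (hd : ∀ i, A i i = 0) (hdet : A.det ≠ 0) :
    ∃ σ : Equiv.Perm n, (∀ i, σ (σ i) = i) ∧ (∀ i, σ i ≠ i) ∧ ∀ i, A i (σ i) ≠ 0 := by
  by_contra hcon
  push Not at hcon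
  apply hdet
  rw [Matrix.det_apply]
  have hprod : ∀ σ : Equiv.Perm n, ∏ i, A (σ⁻¹ i) i = ∏ i, A (σ i) i := by
    intro σ
    rw [← Equiv.prod_comp σ]
    exact Finset.prod_congr rfl fun i _ => by simp [hs i]
  -- The terms of `σ` and `σ⁻¹` agree and cancel. A nonzero term with `σ = σ⁻¹` has no fixed point,
  -- the diagonal being zero, so `hcon` excludes it.
  refine Finset.sum_involution (fun σ _ => σ⁻¹) ?_ ?_ (fun _ _ => mem_univ _)
    (fun _ _ => inv_inv _)
  · intro σ _
    rw [hprod, Equiv.Perm.sign_inv, CharTwo.add_self_eq_zero]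
  · intro σ _ hσ hinv
    have hσ' : ∏ i, A (σ i) i ≠ 0 := fun h => hσ (by rw [h, smul_zero])
    have hne : ∀ i, A (σ i) i ≠ 0 := fun i h => hσ' (Finset.prod_eq_zero (mem_univ i) h)
    have h1 : ∀ i, σ (σ i) = i := fun i => by
      conv_lhs => rw [← hinv]
      rw [hinv]
      nth_rewrite 1 [← hinv]
      simp
    have h2 : ∀ i, σ i ≠ i := fun i h => hne i (by rw [h, hd])
    obtain ⟨i, hi⟩ := hcon σ h1 h2
    exact hne i (by rw [hs, hi])

/-- A symmetric matrix of rank `r` has a nonsingular principal submatrix of size `r`. -/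
theorem Matrix.exists_principal_submatrix_det_ne_zero {n K : Type*} [Fintype n] [Field K]
    (A : Matrix n n K) (hs : ∀ i j, A i j = A j i) :
    ∃ f : Fin A.rank → n, Function.Injective f ∧ (A.submatrix f f).det ≠ 0 := by
  classical
  obtain ⟨κ, a, ha, hsp, hli⟩ := exists_linearIndependent' K A.row
  have : Finite κ := Finite.of_injective a ha
  have : Fintype κ := Fintype.ofFinite κ
  have hcard : Fintype.card κ = A.rank := by
    rw [Matrix.rank_eq_finrank_span_row, ← hsp, finrank_span_eq_card hli]
  let e : Fin A.rank ≃ κ := (finCongr hcard.symm).trans (Fintype.equivFin κ).symm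
  refine ⟨a ∘ e, ha.comp e.injective, fun hdet => ?_⟩
  obtain ⟨v, hv, hv0⟩ := Matrix.exists_vecMul_eq_zero_iff.mpr hdet
  have hli' : LinearIndependent K ((A.row ∘ a) ∘ e) := hli.comp e e.injective
  let w : n → K := ∑ i, v i • A.row (a (e i))
  have hw : ∀ i, w (a (e i)) = 0 := fun i => by
    have := congrFun hv0 i
    simpa [w, Matrix.vecMul, dotProduct, Finset.sum_apply] using this
  have hw0 : w = 0 := by
    funext j
    have hj : A.row j ∈ Submodule.span K (Set.range (A.row ∘ a)) := by
      rw [hsp]; exact Submodule.subset_span ⟨j, rfl⟩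
    -- By symmetry of `A`, the coordinates of `w` are the values of one functional on the rows. It
    -- vanishes on the chosen rows, hence on their span, which contains every row.
    let Λ : (n → K) →ₗ[K] K := ∑ i, v i • LinearMap.proj (a (e i))
    have hΛ : ∀ k, Λ (A.row k) = w k := fun k => by
      simp [Λ, w, Finset.sum_apply, LinearMap.sum_apply, hs k]
    rw [← hΛ, Pi.zero_apply, ← LinearMap.mem_ker]
    refine (Submodule.span_le.mpr ?_) hj
    rintro _ ⟨i, rfl⟩
    simp only [SetLike.mem_coe, LinearMap.mem_ker, Function.comp_apply, hΛ]
    obtain ⟨i, rfl⟩ := e.surjective i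
    exact hw i
  exact hv (funext fun i => Fintype.linearIndependent_iff.mp hli' v hw0 i)

/-- A fixed point free involution of a finite type of size at least `2 * g` gives `g` disjoint
pairs of elements. -/
theorem exists_pairs_of_fixedPointFree_involution {r g : ℕ} (σ : Equiv.Perm (Fin r))
    (h1 : ∀ i, σ (σ i) = i) (h2 : ∀ i, σ i ≠ i) (hr : 2 * g ≤ r) :
    ∃ m : Fin (2 * g) → Fin r, Function.Injective m ∧
      ∀ i : Fin g, m ⟨2 * i + 1, i.two_mul_add_one_lt⟩ = σ (m ⟨2 * i, i.two_mul_lt⟩) := by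
  -- One element of each pair; `σ` maps `R` onto its complement, so `R` has `r / 2` elements.
  let R := Finset.univ.filter fun i : Fin r => i < σ i
  have hR : g ≤ R.card := by
    have hc : (Finset.univ.filter fun i : Fin r => ¬ i < σ i) = R.map σ.toEmbedding := by
      ext i
      simp only [Finset.mem_filter, Finset.mem_univ, true_and, Finset.mem_map_equiv, R]
      have : σ.symm i = σ i := by rw [Equiv.symm_apply_eq, h1]
      rw [this, h1, not_lt]
      exact ⟨fun h => lt_of_le_of_ne h (h2 i), le_of_lt⟩
    have := Finset.card_filter_add_card_filter_not (s := (Finset.univ : Finset (Fin r)))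
      (fun i => i < σ i)
    rw [hc, Finset.card_map, Finset.card_univ, Fintype.card_fin] at this
    have : R.card + R.card = r := this
    omega
  let p : Fin g → Fin r := fun i => R.orderEmbOfFin rfl (Fin.castLE hR i)
  have hp : Function.Injective p :=
    (R.orderEmbOfFin rfl).injective.comp (Fin.castLE_injective hR)
  have hpR : ∀ i, p i < σ (p i) := fun i =>
    (Finset.mem_filter.mp (R.orderEmbOfFin_mem rfl (Fin.castLE hR i))).2
  have hne : ∀ i j, p i ≠ σ (p j) := fun i j h => by
    have := hpR i
    rw [h, h1] at this
    exact lt_asymm this (hpR j)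
  refine ⟨fun k => if k.1 % 2 = 0 then p ⟨k.1 / 2, by omega⟩ else σ (p ⟨k.1 / 2, by omega⟩),
    ?_, ?_⟩
  · intro k l h
    dsimp only at h
    split_ifs at h with hk hl hl
    · have := Fin.mk.inj (hp h); ext; omega
    · exact (hne _ _ h).elim
    · exact (hne _ _ h.symm).elim
    · have := Fin.mk.inj (hp (σ.injective h)); ext; omega
  · intro i
    have e1 : (2 * i.1 + 1) % 2 ≠ 0 := by omega
    have e2 : (2 * i.1) % 2 = 0 := by omega
    have e3 : (2 * i.1 + 1) / 2 = i := by omega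
    have e4 : (2 * i.1) / 2 = i := by omega
    simp [e2, e3, e4]

/-- A symmetric matrix with zero diagonal and of rank at least `2 * g` in characteristic two has
`g` nonzero entries in disjoint rows and columns. -/
theorem Matrix.exists_matching_of_rank {n K : Type*} [Fintype n] [Field K] [CharP K 2]
    (A : Matrix n n K) (hs : ∀ i j, A i j = A j i) (hd : ∀ i, A i i = 0) {g : ℕ}
    (hr : 2 * g ≤ A.rank) :
    ∃ m : Fin (2 * g) → n, Function.Injective m ∧
      ∀ i : Fin g, A (m ⟨2 * i, i.two_mul_lt⟩) (m ⟨2 * i + 1, i.two_mul_add_one_lt⟩) ≠ 0 := by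
  obtain ⟨f, hf, hdet⟩ := A.exists_principal_submatrix_det_ne_zero hs
  obtain ⟨σ, h1, h2, h3⟩ := (A.submatrix f f).exists_fixedPointFree_involution
    (fun i j => hs _ _) (fun i => hd _) hdet
  obtain ⟨m, hm, hm'⟩ := exists_pairs_of_fixedPointFree_involution σ h1 h2 hr
  exact ⟨f ∘ m, hf.comp hm, fun i => by simpa [hm'] using h3 (m ⟨2 * i, i.two_mul_lt⟩)⟩

/-! ### Cycles and trees in multigraphs -/

namespace Graph

variable {α β : Type*}

/-- An edge outside a set `S` of edges together with a path of edges of `S` between its ends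
contains a cycle through that edge. -/
theorem IsLink.exists_isCycleGraph {G : Graph α β} {S : Set β} {e : β} {x y : α}
    (he : G.IsLink e x y) (heS : e ∉ S)
    (hxy : Relation.ReflTransGen (fun a b => ∃ f ∈ S, G.IsLink f a b) x y) :
    ∃ C ≤ G, C.IsCycleGraph ∧ e ∈ E(C) ∧ E(C) ⊆ insert e S := by
  classical
  -- Forgetting loops and multiplicities gives access to paths with distinct vertices. If `x = y`,
  -- the path has length zero and the cycle is the loop `e`.
  let H : SimpleGraph α := SimpleGraph.fromRel fun a b => ∃ f ∈ S, G.IsLink f a b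
  have hreach : H.Reachable x y := by
    clear he
    induction hxy with
    | refl => rfl
    | @tail b c _ hbc ih =>
      by_cases h : b = c
      · exact h ▸ ih
      · exact ih.trans (SimpleGraph.Adj.reachable
          ((SimpleGraph.fromRel_adj _ _ _).mpr ⟨h, Or.inl hbc⟩))
  obtain ⟨p, hp⟩ := hreach.exists_isPath
  have hinj : ∀ k ≤ p.length, ∀ l ≤ p.length, p.getVert k = p.getVert l → k = l :=
    fun k hk l hl h => hp.getVert_injOn hk hl h
  have hF : ∀ k, ∃ f, k < p.length → f ∈ S ∧ G.IsLink f (p.getVert k) (p.getVert (k + 1)) := by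
    intro k
    by_cases hk : k < p.length
    · obtain ⟨-, ⟨f, hf, hl⟩ | ⟨f, hf, hl⟩⟩ :=
        (SimpleGraph.fromRel_adj _ _ _).mp (p.adj_getVert_succ hk)
      · exact ⟨f, fun _ => ⟨hf, hl⟩⟩
      · exact ⟨f, fun _ => ⟨hf, hl.symm⟩⟩
    · exact ⟨e, fun h => absurd h hk⟩
  choose F hF using hF
  let v : Fin (p.length + 1) → α := fun i => p.getVert i
  -- The last index carries `e`: there `i + 1` wraps around to `0`, and `e` closes the path.
  let d : Fin (p.length + 1) → β := fun i => if (i : ℕ) < p.length then F i else e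
  have hlink : ∀ i, G.IsLink (d i) (v i) (v (i + 1)) := by
    intro i
    by_cases hi : (i : ℕ) < p.length
    · have : ((i + 1 : Fin _) : ℕ) = i + 1 := by
        rw [Fin.val_add_one, if_neg]
        rintro rfl
        simp at hi
      simp only [d, v, if_pos hi, this]
      exact (hF i hi).2
    · have hl : i = Fin.last _ := Fin.ext (by simp; omega)
      subst hl
      simpa [d, v] using he.symm
  have hdS : ∀ i : Fin (p.length + 1), (i : ℕ) < p.length → d i ∈ S := fun i hi => by
    simpa only [d, if_pos hi] using (hF i hi).1
  have hd : Function.Injective d := by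
    intro i j h
    by_cases hi : (i : ℕ) < p.length <;> by_cases hj : (j : ℕ) < p.length
    · have h' : F i = F j := by simpa only [d, if_pos hi, if_pos hj] using h
      have h1 := (hF i hi).2
      rw [h'] at h1
      obtain ⟨h2, -⟩ | ⟨h2, h3⟩ := h1.eq_and_eq_or_eq_and_eq (hF j hj).2
      · exact Fin.ext (hinj _ hi.le _ hj.le h2)
      · have := hinj _ hi.le _ hj h2
        have := hinj _ hi _ hj.le h3
        omega
    · have h' : d j = e := if_neg hj
      exact absurd (h' ▸ h ▸ hdS i hi) heS
    · have h' : d i = e := if_neg hi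
      exact absurd (h' ▸ h.symm ▸ hdS j hj) heS
    · ext; omega
  let C : Graph α β :=
    { vertexSet := Set.range v
      IsLink := fun f a b => f ∈ Set.range d ∧ G.IsLink f a b
      isLink_symm := fun f _ => ⟨fun a b h => ⟨h.1, h.2.symm⟩⟩
      eq_or_eq_of_isLink_of_isLink := fun f a b c d h h' => h.2.left_eq_or_eq h'.2
      left_mem_of_isLink := by
        rintro f a b ⟨⟨i, rfl⟩, h⟩
        obtain rfl | rfl := h.left_eq_or_eq (hlink i)
        · exact ⟨_, rfl⟩
        · exact ⟨_, rfl⟩ }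
  have hE : E(C) = Set.range d := by
    ext f
    refine ⟨fun ⟨_, _, h⟩ => h.1, ?_⟩
    rintro ⟨i, rfl⟩
    exact ⟨_, _, ⟨i, rfl⟩, hlink i⟩
  refine ⟨C, ⟨?_, fun f a b h => h.2⟩, ⟨p.length + 1, inferInstance, v, d, ?_, hd, rfl, hE,
    fun i => ⟨⟨i, rfl⟩, hlink i⟩⟩, ?_, ?_⟩
  · rintro _ ⟨i, rfl⟩
    exact (hlink i).left_mem
  · exact fun i j h => Fin.ext (hinj _ (by omega) _ (by omega) h)
  · rw [hE]
    exact ⟨Fin.last _, by simp [d]⟩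
  · rw [hE]
    rintro _ ⟨i, rfl⟩
    by_cases hi : (i : ℕ) < p.length
    · exact Or.inr (hdS i hi)
    · exact Or.inl (if_neg hi)

/-- The ends of an edge of a tree are not joined by a path that avoids the edge. -/
theorem IsTreeGraph.not_reflTransGen {T : Graph α β} (hT : T.IsTreeGraph) {e : β} {x y : α}
    (he : T.IsLink e x y) :
    ¬ Relation.ReflTransGen (fun a b => ∃ f ≠ e, T.IsLink f a b) x y := by
  intro h
  obtain ⟨C, hC, hc, -⟩ := he.exists_isCycleGraph (S := {f | f ≠ e}) (by simp) h
  exact hT.2 C hC hc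

/-- Every edge outside a spanning tree has a fundamental cycle. -/
theorem IsSpanningTree.exists_isFundamentalCycle {T G : Graph α β} (hT : T.IsSpanningTree G)
    {e : β} (he : e ∈ E(G) \ E(T)) : ∃ C, G.IsFundamentalCycle T e C := by
  obtain ⟨x, y, hxy⟩ := G.exists_isLink_of_mem_edgeSet he.1
  have hc := hT.2.1.2 x (hT.1.vertexSet_eq ▸ hxy.left_mem) y (hT.1.vertexSet_eq ▸ hxy.right_mem)
  obtain ⟨C, hC, h1, h2, h3⟩ := hxy.exists_isCycleGraph (S := E(T)) he.2
    (Relation.ReflTransGen.mono (fun a b ⟨f, hf⟩ => ⟨f, hf.edge_mem, hf.mono hT.1.le⟩) _ _ hc)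
  exact ⟨C, he, hC, h1, h2, h3⟩

end Graph

/-! ### Chains modulo two, potentials and the intersection form -/

theorem Equiv.Perm.SameCycle.apply_eq_of_invariant {D A : Type*} {π : Equiv.Perm D} {h : D → A}
    (hh : ∀ d, h (π d) = h d) {d d' : D} (hd : π.SameCycle d d') : h d = h d' := by
  have hn : ∀ (n : ℕ) d, h ((π ^ n) d) = h d := by
    intro n
    induction n with
    | zero => simp
    | succ n ih => intro d; rw [pow_succ', Equiv.Perm.mul_apply, hh, ih]
  obtain ⟨n | n, rfl⟩ := hd
  · exact (hn n d).symm
  · rw [← hn (n + 1) ((π ^ (Int.negSucc n)) d), ← zpow_natCast, ← Equiv.Perm.mul_apply, ← zpow_add]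
    simp [Int.negSucc_eq]

namespace OrientedEmbedding

variable {α β D : Type*} {G : Graph α β} (M : OrientedEmbedding G D)

theorem edge_rev (d : D) : M.edge (M.rev d) = M.edge d :=
  ((M.edge_eq_iff d (M.rev d)).mpr (Or.inr rfl)).symm

theorem vert_next (d : D) : M.vert (M.next d) = M.vert d :=
  ((M.vert_eq_iff d (M.next d)).mpr ⟨1, by simp⟩).symm

theorem faceOf_facePerm (d : D) : M.faceOf (M.facePerm d) = M.faceOf d :=
  congrArg Sum.inl (Quotient.sound (s := Equiv.Perm.SameCycle.setoid M.facePerm) ⟨-1, by simp⟩)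

theorem facePerm_rev (d : D) : M.facePerm (M.rev d) = M.next d := by
  simp [facePerm, M.rev_rev]

/-- A set of darts that contains exactly one dart of every edge. -/
def IsOrientation (P : Finset D) : Prop := ∀ d, M.rev d ∈ P ↔ d ∉ P

theorem exists_isOrientation [Fintype D] : ∃ P : Finset D, M.IsOrientation P := by
  classical
  let f := Fintype.equivFin D
  refine ⟨Finset.univ.filter fun d => f d < f (M.rev d), fun d => ?_⟩
  have : f (M.rev d) ≠ f d := fun h => M.rev_ne d (f.injective h)
  simp only [Finset.mem_filter, Finset.mem_univ, true_and, M.rev_rev, not_lt]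
  exact ⟨le_of_lt, fun h => lt_of_le_of_ne h this⟩

variable {M}

theorem IsOrientation.sum_add_rev [Fintype D] {P : Finset D} (hP : M.IsOrientation P)
    {A : Type*} [AddCommMonoid A] (h : D → A) :
    ∑ d ∈ P, (h d + h (M.rev d)) = ∑ d, h d := by
  classical
  have hc : (Finset.univ.filter fun d => d ∉ P) = P.map M.rev.toEmbedding := by
    ext d
    have : M.rev.symm d = M.rev d := by rw [Equiv.symm_apply_eq, M.rev_rev]
    simp [Finset.mem_map_equiv, this, hP d]
  rw [← Finset.sum_filter_add_sum_filter_not Finset.univ (fun d => d ∈ P), hc,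
    Finset.sum_map, Finset.sum_add_distrib]
  simp

theorem IsOrientation.card [Fintype D] {P : Finset D} (hP : M.IsOrientation P) :
    P.card = E(G).ncard := by
  have h : M.edge '' P = E(G) := by
    ext e
    constructor
    · rintro ⟨d, -, rfl⟩
      exact (M.isLink d).edge_mem
    · intro he
      obtain ⟨d, rfl⟩ := M.edge_surj e he
      by_cases hd : d ∈ P
      · exact ⟨d, hd, rfl⟩
      · exact ⟨M.rev d, (hP d).mpr hd, M.edge_rev d⟩
  rw [← h, Set.InjOn.ncard_image, Set.ncard_coe_finset]
  intro d hd d' hd' h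
  obtain rfl | rfl := (M.edge_eq_iff d d').mp h
  · rfl
  · exact absurd hd ((hP d).mp hd')

variable (M)

/-- The darts at a vertex form a single orbit of `next`, so an invariant function descends to the
vertices. -/
theorem exists_eq_comp_vert {h : D → ZMod 2} (hh : ∀ d, h (M.next d) = h d) :
    ∃ u : α → ZMod 2, ∀ d, h d = u (M.vert d) := by
  have hf : Function.FactorsThrough h M.vert := fun d d' hd =>
    ((M.vert_eq_iff d d').mp hd).apply_eq_of_invariant hh
  exact ⟨Function.extend M.vert h 0, fun d => (hf.extend_apply 0 d).symm⟩

/-- The cycles modulo two of the embedded graph, as functions of the darts. -/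
structure IsCycleChain [Fintype D] (z : D → ZMod 2) : Prop where
  rev : ∀ d, z (M.rev d) = z d
  sum_eq_zero : ∀ u : α → ZMod 2, ∑ d, z d * u (M.vert d) = 0

/-- A potential of a cycle `z` modulo two: a function of the corners whose jumps at the darts
are given by `z`. -/
def IsPotential (z c : D → ZMod 2) : Prop := ∀ d, c (M.next d) = c d + z d

/-- The cochain that is Poincaré dual to the cycle `z` with potential `c`: it measures how the
potential changes along the sides of an edge. -/
def dualCochain (z c : D → ZMod 2) (d : D) : ZMod 2 := c d + c (M.rev d) + z d

variable {M}

/-- Duality in linear algebra: the equation for `c` says that pairing with `z` factors through `f`,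
so it is solvable once `z` annihilates the kernel of `f`. That kernel consists of the functions
constant around each vertex, to which closedness of `z` applies. -/
theorem IsCycleChain.exists_isPotential [Fintype D] {z : D → ZMod 2} (hz : M.IsCycleChain z) :
    ∃ c, M.IsPotential z c := by
  classical
  let f : (D → ZMod 2) →ₗ[ZMod 2] (D → ZMod 2) :=
    LinearMap.funLeft (ZMod 2) (ZMod 2) M.next.symm - LinearMap.id
  let Z : Module.Dual (ZMod 2) (D → ZMod 2) := Fintype.linearCombination (ZMod 2) z
  have hZ : Z ∈ LinearMap.range f.dualMap := by
    rw [LinearMap.range_dualMap_eq_dualAnnihilator_ker, Submodule.mem_dualAnnihilator]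
    intro h hh
    have hinv : ∀ d, h (M.next d) = h d := fun d => by
      have := congrFun (LinearMap.mem_ker.mp hh) (M.next d)
      simp [f, LinearMap.funLeft_apply, sub_eq_zero] at this
      exact this.symm
    obtain ⟨u, hu⟩ := M.exists_eq_comp_vert hinv
    rw [← hz.sum_eq_zero u]
    simp [Z, Fintype.linearCombination_apply, hu, mul_comm]
  obtain ⟨c, hc⟩ := hZ
  refine ⟨fun d => c (Pi.single d 1), fun d => ?_⟩
  have h1 := LinearMap.congr_fun hc (Pi.single d 1)
  have h2 : f (Pi.single d 1) = Pi.single (M.next d) 1 - Pi.single d 1 := by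
    ext x
    simp only [f, LinearMap.sub_apply, LinearMap.funLeft_apply, LinearMap.id_apply, Pi.sub_apply,
      Pi.single_apply, Equiv.symm_apply_eq]
  rw [LinearMap.dualMap_apply, h2, map_sub] at h1
  simp [Z, Fintype.linearCombination_apply_single] at h1
  rw [← h1]
  ring

theorem IsOrientation.sum_mul_coboundary [Fintype D] {P : Finset D} (hP : M.IsOrientation P)
    {z : D → ZMod 2} (hz : M.IsCycleChain z) (u : α → ZMod 2) :
    ∑ d ∈ P, z d * (u (M.vert d) + u (M.vert (M.rev d))) = 0 := by
  rw [← hz.sum_eq_zero u, ← hP.sum_add_rev]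
  exact Finset.sum_congr rfl fun d _ => by rw [hz.rev]; ring

/-- The two corner terms of an edge merge into a sum over all darts, leaving the number of common
edges as a correction. This form suits summation around vertices. -/
theorem IsOrientation.sum_mul_dualCochain [Fintype D] {P : Finset D} (hP : M.IsOrientation P)
    {z y : D → ZMod 2} (hy : M.IsCycleChain y) (c : D → ZMod 2) :
    ∑ d ∈ P, y d * M.dualCochain z c d = ∑ d, y d * c d + ∑ d ∈ P, y d * z d := by
  rw [← hP.sum_add_rev, ← Finset.sum_add_distrib]
  exact Finset.sum_congr rfl fun d _ => by rw [hy.rev, dualCochain]; ring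

theorem dualCochain_rev {z c : D → ZMod 2} (hz : ∀ d, z (M.rev d) = z d) (d : D) :
    M.dualCochain z c (M.rev d) = M.dualCochain z c d := by
  rw [dualCochain, dualCochain, hz, M.rev_rev]
  ring

/-- The intersection form is symmetric. -/
theorem IsOrientation.intersection_symm [Fintype D] {P : Finset D} (hP : M.IsOrientation P)
    {z y c b : D → ZMod 2} (hz : M.IsCycleChain z) (hy : M.IsCycleChain y)
    (hc : M.IsPotential z c) (hb : M.IsPotential y b) :
    ∑ d ∈ P, y d * M.dualCochain z c d = ∑ d ∈ P, z d * M.dualCochain y b d := by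
  have h2 : (2 : ZMod 2) = 0 := rfl
  rw [hP.sum_mul_dualCochain hy, hP.sum_mul_dualCochain hz, Finset.sum_congr rfl
    fun d _ => mul_comm (z d) (y d), add_left_inj, ← sub_eq_zero, ← Finset.sum_sub_distrib]
  have h1 : ∑ d, y d * z d = 0 := by
    rw [← hP.sum_add_rev]
    exact Finset.sum_eq_zero fun d _ => by rw [hz.rev, hy.rev]; linear_combination y d * z d * h2
  -- Summation by parts: expanding `(b + y) * (c + z) - b * c` gives `b * z + y * c + y * z`, with
  -- total zero; the sum of `y * z` vanishes by `h1`.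
  have h3 := Equiv.sum_comp M.next fun d => b d * c d
  rw [← sub_eq_zero, ← Finset.sum_sub_distrib] at h3
  rw [← h1, ← sub_eq_zero, ← Finset.sum_sub_distrib, ← neg_eq_zero, ← Finset.sum_neg_distrib,
    ← h3]
  refine Finset.sum_congr rfl fun d _ => ?_
  rw [hc d, hb d]
  linear_combination - (y d * c d) * h2

/-- The intersection form is alternating. -/
theorem IsOrientation.intersection_self [Fintype D] {P : Finset D} (hP : M.IsOrientation P)
    {z c : D → ZMod 2} (hz : M.IsCycleChain z) (hc : M.IsPotential z c) :
    ∑ d ∈ P, z d * M.dualCochain z c d = 0 := by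
  -- The potential is lifted to integers so that an equation can be halved: the darts of `z` number
  -- twice its edges and also, as jumps of a 0-1 function, twice the sum of `a d - a d * a (M.next
  -- d)`.
  let a : D → ℤ := fun d => (c d).val
  have h1 : ∑ d, ((z d).val : ℤ) = 2 * ∑ d, (a d - a d * a (M.next d)) := by
    have h3 := Equiv.sum_comp M.next a
    have : ∀ d, ((z d).val : ℤ) = a d + a (M.next d) - 2 * (a d * a (M.next d)) := fun d => by
      simp only [a, hc d]
      generalize z d = x
      generalize c d = y
      revert x y
      decide
    simp only [this, Finset.sum_sub_distrib, Finset.sum_add_distrib, ← Finset.mul_sum, h3]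
    ring
  have h2 : ∑ d, ((z d).val : ℤ) = 2 * ∑ d ∈ P, ((z d).val : ℤ) := by
    rw [← hP.sum_add_rev, Finset.mul_sum]
    exact Finset.sum_congr rfl fun d _ => by rw [hz.rev]; ring
  have h3 : ∑ d, (a d - a d * a (M.next d)) = ∑ d ∈ P, ((z d).val : ℤ) := by omega
  have h4 := congrArg (Int.cast : ℤ → ZMod 2) h3
  have hcast : ∀ x : ZMod 2, (((x.val : ℕ) : ℤ) : ZMod 2) = x := by decide
  simp only [Int.cast_sum, Int.cast_sub, Int.cast_mul, a, hcast] at h4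
  rw [hP.sum_mul_dualCochain hz]
  have h5 : ∑ d, z d * c d = ∑ d, (c d - c d * c (M.next d)) :=
    Finset.sum_congr rfl fun d _ => by
      rw [hc d]
      generalize z d = x
      generalize c d = y
      revert x y
      decide
  have h6 : ∑ d ∈ P, z d * z d = ∑ d ∈ P, z d :=
    Finset.sum_congr rfl fun d _ => by
      generalize z d = x
      revert x
      decide
  rw [h5, h6, h4, CharTwo.add_self_eq_zero]

/-- A cycle that bounds a set of faces intersects every cycle an even number of times. -/
theorem IsOrientation.intersection_eq_zero_of_boundary [Fintype D] {P : Finset D}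
    (hP : M.IsOrientation P) {z y c k : D → ZMod 2} (hy : M.IsCycleChain y)
    (hc : M.IsPotential z c) (hk : ∀ d, k (M.facePerm d) = k d)
    (hzk : ∀ d, z d = k d + k (M.rev d)) :
    ∑ d ∈ P, y d * M.dualCochain z c d = 0 := by
  have h2 : (2 : ZMod 2) = 0 := rfl
  have hkn : ∀ d, k (M.next d) = k (M.rev d) := fun d => by rw [← M.facePerm_rev, hk]
  -- Both `c` and `k` jump by `z` around a vertex, so their sum is a vertex function `u`, and the
  -- dual cochain is its coboundary.
  obtain ⟨u, hu⟩ := M.exists_eq_comp_vert (h := fun d => c d + k d) fun d => by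
    rw [hc d, hkn, hzk]
    linear_combination k (M.rev d) * h2
  rw [← hP.sum_mul_coboundary hy u]
  refine Finset.sum_congr rfl fun d _ => ?_
  rw [← hu, ← hu, dualCochain, hzk]
  ring

/-- The converse: Poincaré duality. -/
theorem boundary_of_dualCochain_eq_coboundary {z c : D → ZMod 2} (hz : ∀ d, z (M.rev d) = z d)
    (hc : M.IsPotential z c) {u : α → ZMod 2}
    (hu : ∀ d, M.dualCochain z c d = u (M.vert d) + u (M.vert (M.rev d))) :
    ∃ k : M.Face → ZMod 2, ∀ d, z d = k (M.faceOf d) + k (M.faceOf (M.rev d)) := by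
  have h2 : (2 : ZMod 2) = 0 := rfl
  -- Correcting the potential by `u` makes it constant along facial walks.
  let h : D → ZMod 2 := fun d => c d + u (M.vert d)
  have hh : ∀ d, h (M.facePerm d) = h d := fun d => by
    have h1 := hu d
    have h3 : c (M.facePerm d) = c (M.rev d) + z (M.rev d) := hc (M.rev d)
    have h4 : M.vert (M.facePerm d) = M.vert (M.rev d) := M.vert_next _
    simp only [dualCochain] at h1
    simp only [h, h3, h4, hz]
    linear_combination h1 + (u (M.vert (M.rev d)) - c d) * h2
  -- A face at an isolated vertex meets no dart; its value `0` is arbitrary.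
  refine ⟨Sum.elim (Quotient.lift (s := Equiv.Perm.SameCycle.setoid M.facePerm) h
    fun d d' hd => Equiv.Perm.SameCycle.apply_eq_of_invariant hh hd) 0, fun d => ?_⟩
  change z d = h d + h (M.rev d)
  have h1 := hu d
  simp only [dualCochain] at h1
  linear_combination h1 - (c d + c (M.rev d)) * h2

end OrientedEmbedding

/-! ### Cycle graphs as chains -/

namespace OrientedEmbedding

variable {α β D : Type*} {G : Graph α β} (M : OrientedEmbedding G D)

theorem exists_dart_of_isLink {e : β} {x y : α} (h : G.IsLink e x y) :
    ∃ d, M.edge d = e ∧ M.vert d = x ∧ M.vert (M.rev d) = y := by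
  obtain ⟨d, rfl⟩ := M.edge_surj e h.edge_mem
  obtain ⟨h1, h2⟩ | ⟨h1, h2⟩ := h.eq_and_eq_or_eq_and_eq (M.isLink d)
  · exact ⟨d, rfl, h1.symm, h2.symm⟩
  · exact ⟨M.rev d, M.edge_rev d, h1.symm, by rw [M.rev_rev, h2]⟩

/-- A cycle of the embedded graph is traced by a cyclic sequence of darts. -/
theorem exists_darts_of_isCycleGraph {C : Graph α β} (hC : C.IsCycleGraph) (hCG : C ≤ G) :
    ∃ (n : ℕ) (_ : NeZero n) (δ : Fin n → D), Function.Injective (fun i => M.vert (δ i)) ∧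
      Function.Injective (fun i => M.edge (δ i)) ∧ V(C) = Set.range (fun i => M.vert (δ i)) ∧
      E(C) = Set.range (fun i => M.edge (δ i)) ∧
      ∀ i, M.vert (M.rev (δ i)) = M.vert (δ (i + 1)) := by
  obtain ⟨n, hn, v, e, hv, he, hV, hE, hl⟩ := hC
  choose δ h1 h2 h3 using fun i => M.exists_dart_of_isLink ((hl i).mono hCG)
  refine ⟨n, hn, δ, ?_, ?_, ?_, ?_, fun i => by rw [h3, h2]⟩
  · simpa only [h2] using hv
  · simpa only [h1] using he
  · simpa only [h2] using hV
  · simpa only [h1] using hE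

variable {M}

theorem sum_eq_sum_darts [Fintype D] {n : ℕ} {δ : Fin n → D}
    (hδ : Function.Injective (fun i => M.edge (δ i))) (h : D → ZMod 2)
    (hh : ∀ d, M.edge d ∉ Set.range (fun i => M.edge (δ i)) → h d = 0) :
    ∑ d, h d = ∑ i, (h (δ i) + h (M.rev (δ i))) := by
  rw [Finset.sum_add_distrib]
  have := Fintype.sum_of_injective (Sum.elim δ fun i => M.rev (δ i)) ?_
    (fun i => h (Sum.elim δ (fun i => M.rev (δ i)) i)) h ?_ (fun _ => rfl)
  · rw [← this, Fintype.sum_sum_type]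
    rfl
  · refine Function.Injective.sumElim (fun i j hij => hδ (congrArg M.edge hij))
      (fun i j hij => hδ (congrArg M.edge (M.rev.injective hij))) fun i j hij => ?_
    obtain rfl : i = j := hδ (by simp only [hij, M.edge_rev])
    exact M.rev_ne _ hij.symm
  · intro d hd
    refine hh d fun ⟨i, hi⟩ => hd ?_
    obtain rfl | rfl := (M.edge_eq_iff (δ i) d).mp hi
    · exact ⟨Sum.inl i, rfl⟩
    · exact ⟨Sum.inr i, rfl⟩

variable (M) in
open Classical in
/-- The chain modulo two of the edges of a subgraph. -/
noncomputable def chain (C : Graph α β) (d : D) : ZMod 2 := if M.edge d ∈ E(C) then 1 else 0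

theorem isCycleChain_chain [Fintype D] {C : Graph α β} (hC : C.IsCycleGraph) (hCG : C ≤ G) :
    M.IsCycleChain (M.chain C) := by
  obtain ⟨n, hn, δ, -, h2, -, h4, h5⟩ := M.exists_darts_of_isCycleGraph hC hCG
  refine ⟨fun d => by rw [chain, chain, M.edge_rev], fun u => ?_⟩
  rw [sum_eq_sum_darts h2 _ fun d hd => by rw [chain, if_neg (h4 ▸ hd), zero_mul]]
  have : ∀ i, M.chain C (δ i) = 1 := fun i => if_pos (by rw [h4]; exact ⟨i, rfl⟩)
  have h' : ∀ i, M.chain C (M.rev (δ i)) = 1 := fun i => by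
    rw [← this i, chain, chain, M.edge_rev]
  simp only [this, h', h5, one_mul]
  -- The heads of the darts are their tails shifted by one, so each vertex of the cycle is counted
  -- twice.
  have hs := Equiv.sum_comp (Equiv.addRight (1 : Fin n)) fun i => u (M.vert (δ i))
  simp only [Equiv.coe_addRight] at hs
  rw [Finset.sum_add_distrib, hs, CharTwo.add_self_eq_zero]

/-- The only cycles modulo two within a cycle graph are zero and the whole cycle. -/
theorem IsCycleChain.eq_zero_or_eq_chain [Fintype D] {C : Graph α β} (hC : C.IsCycleGraph)
    (hCG : C ≤ G) {y : D → ZMod 2} (hy : M.IsCycleChain y)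
    (hyC : ∀ d, M.edge d ∉ E(C) → y d = 0) : y = 0 ∨ y = M.chain C := by
  classical
  obtain ⟨n, hn, δ, h1, h2, -, h4, h5⟩ := M.exists_darts_of_isCycleGraph hC hCG
  have hstep : ∀ i, y (δ (i + 1)) = y (δ i) := fun i => by
    -- Testing at this vertex sees only two darts of the cycle, `δ (i + 1)` and `M.rev (δ i)`.
    have h := hy.sum_eq_zero (Pi.single (M.vert (δ (i + 1))) 1)
    rw [sum_eq_sum_darts h2 _ fun d hd => by rw [hyC d (h4 ▸ hd), zero_mul]] at h
    simp only [hy.rev, h5, Pi.single_apply, h1.eq_iff, add_left_inj, mul_ite, mul_one, mul_zero,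
      Finset.sum_add_distrib, Finset.sum_ite_eq', Finset.mem_univ, if_true] at h
    rw [← sub_eq_zero, CharTwo.sub_eq_add, h]
  have hconst : ∀ k : ℕ, y (δ (Fin.ofNat n k)) = y (δ (Fin.ofNat n 0)) := by
    intro k
    induction k with
    | zero => rfl
    | succ k ih =>
      rw [← ih, ← hstep (Fin.ofNat n k)]
      congr 2
      ext
      simp [Fin.val_add]
  have hy0 : ∀ d, M.edge d ∈ E(C) → y d = y (δ (Fin.ofNat n 0)) := fun d hd => by
    rw [h4] at hd
    obtain ⟨i, hi⟩ := hd
    have : y (δ i) = y (δ (Fin.ofNat n 0)) := by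
      rw [← hconst i]
      congr 2
      ext
      simp
    obtain rfl | rfl := (M.edge_eq_iff (δ i) d).mp hi
    · exact this
    · rw [hy.rev, this]
  have h01 : ∀ x : ZMod 2, x = 0 ∨ x = 1 := by decide
  rcases h01 (y (δ (Fin.ofNat n 0))) with h | h
  · left
    funext d
    by_cases hd : M.edge d ∈ E(C)
    · rw [hy0 d hd, h, Pi.zero_apply]
    · exact hyC d hd
  · right
    funext d
    by_cases hd : M.edge d ∈ E(C)
    · rw [hy0 d hd, h, chain, if_pos hd]
    · rw [hyC d hd, chain, if_neg hd]

/-- Cycles that intersect an odd number of times have a common vertex. -/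
theorem IsOrientation.inter_nonempty [Fintype D] {P : Finset D}
    (hP : M.IsOrientation P) {C C' : Graph α β} (hCG : C ≤ G)
    (hC' : C'.IsCycleGraph) (hC'G : C' ≤ G) {c : D → ZMod 2} (hc : M.IsPotential (M.chain C) c)
    (h : ∑ d ∈ P, M.chain C' d * M.dualCochain (M.chain C) c d ≠ 0) :
    (V(C) ∩ V(C')).Nonempty := by
  classical
  by_contra hdisj
  rw [Set.not_nonempty_iff_eq_empty] at hdisj
  have hy := M.isCycleChain_chain hC' hC'G
  have hz : ∀ d, M.vert d ∈ V(C') → M.chain C d = 0 := fun d hd => by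
    refine if_neg fun he => ?_
    have := ((Graph.IsSubgraph.isLink_iff hCG he).mpr (M.isLink d)).left_mem
    exact (hdisj ▸ (⟨this, hd⟩ : M.vert d ∈ V(C) ∩ V(C')) : M.vert d ∈ (∅ : Set α))
  have hv : ∀ d, M.chain C' d ≠ 0 → M.vert d ∈ V(C') := fun d hd => by
    have he : M.edge d ∈ E(C') := by
      by_contra he
      exact hd (if_neg he)
    exact ((Graph.IsSubgraph.isLink_iff hC'G he).mpr (M.isLink d)).left_mem
  apply h
  -- No dart at a vertex of `C'` lies on `C`, so `c` is constant around such a vertex; cut off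
  -- elsewhere, it becomes a vertex function, which pairs to zero with `C'`.
  obtain ⟨u, hu⟩ := M.exists_eq_comp_vert (h := fun d => if M.vert d ∈ V(C') then c d else 0)
    fun d => by
      simp only [M.vert_next]
      split_ifs with hd
      · rw [hc, hz d hd, add_zero]
      · rfl
  rw [hP.sum_mul_dualCochain hy, Finset.sum_eq_zero (s := P), add_zero, ← hy.sum_eq_zero u]
  · refine Finset.sum_congr rfl fun d _ => ?_
    by_cases hd : M.chain C' d = 0
    · rw [hd, zero_mul, zero_mul]
    · rw [← hu, if_pos (hv d hd)]
  · intro d _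
    by_cases hd : M.chain C' d = 0
    · rw [hd, zero_mul]
    · rw [hz d (hv d hd), mul_zero]

/-! ### Coboundaries on trees -/

/-- Every cochain on the edges of a tree is a coboundary. -/
theorem IsOrientation.exists_coboundary_on_tree {P : Finset D}
    (hP : M.IsOrientation P) {T : Graph α β} (hT : T.IsTreeGraph) (hTG : T ≤ G)
    {φ : D → ZMod 2} (hφ : ∀ d, φ (M.rev d) = φ d) :
    ∃ u : α → ZMod 2, ∀ d, M.edge d ∈ E(T) → φ d = u (M.vert d) + u (M.vert (M.rev d)) := by
  classical
  have hlink : ∀ d, M.edge d ∈ E(T) → T.IsLink (M.edge d) (M.vert d) (M.vert (M.rev d)) :=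
    fun d hd => (Graph.IsSubgraph.isLink_iff hTG hd).mpr (M.isLink d)
  -- The side of `M.vert t` in the cut of `T` made by deleting the edge of `t`; on the tree, its
  -- coboundary is the indicator of that edge.
  let u : D → α → ZMod 2 := fun t w =>
    if Relation.ReflTransGen (fun a b => ∃ f ≠ M.edge t, T.IsLink f a b) (M.vert t) w
    then 1 else 0
  have hu1 : ∀ t, M.edge t ∈ E(T) → u t (M.vert t) + u t (M.vert (M.rev t)) = 1 :=
    fun t ht => by
      simp only [u]
      rw [if_pos Relation.ReflTransGen.refl, if_neg (hT.not_reflTransGen (hlink t ht)), add_zero]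
  have hu : ∀ t, M.edge t ∈ E(T) → ∀ d, M.edge d ∈ E(T) →
      u t (M.vert d) + u t (M.vert (M.rev d)) = if t = d ∨ t = M.rev d then 1 else 0 := by
    intro t ht d hd
    split_ifs with h
    · obtain rfl | rfl := h
      · exact hu1 _ ht
      · have := hu1 _ ht
        rwa [M.rev_rev, add_comm] at this
    · have hne : M.edge d ≠ M.edge t := fun h' => h ((M.edge_eq_iff d t).mp h')
      have hiff : u t (M.vert d) = u t (M.vert (M.rev d)) := by
        simp only [u]
        congr 1
        exact propext ⟨fun h => h.tail ⟨_, hne, hlink d hd⟩,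
          fun h => h.tail ⟨_, hne, (hlink d hd).symm⟩⟩
      rw [hiff, CharTwo.add_self_eq_zero]
  refine ⟨fun w => ∑ t ∈ P with M.edge t ∈ E(T), φ t * u t w, fun d hd => ?_⟩
  rw [← Finset.sum_add_distrib]
  have : ∀ t ∈ P.filter (fun t => M.edge t ∈ E(T)),
      φ t * u t (M.vert d) + φ t * u t (M.vert (M.rev d)) =
        if t = (if d ∈ P then d else M.rev d) then φ d else 0 := by
    intro t ht
    rw [Finset.mem_filter] at ht
    rw [← mul_add, hu t ht.2 d hd, mul_ite, mul_one, mul_zero]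
    have hr := hP d
    by_cases hdP : d ∈ P
    · have : t ≠ M.rev d := fun h => (hr.mp (h ▸ ht.1)) hdP
      simp only [this, or_false, if_pos hdP]
      split_ifs with h
      · rw [h]
      · rfl
    · have : t ≠ d := fun h => hdP (h ▸ ht.1)
      simp only [this, false_or, if_neg hdP]
      split_ifs with h
      · rw [h, hφ]
      · rfl
  rw [Finset.sum_congr rfl this, Finset.sum_ite_eq', if_pos]
  rw [Finset.mem_filter]
  split_ifs with h
  · exact ⟨h, hd⟩
  · exact ⟨(hP d).mpr h, by rwa [M.edge_rev]⟩

open Classical in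
/-- A tree has fewer edges than vertices. -/
theorem IsOrientation.card_tree_lt {P : Finset D} (hP : M.IsOrientation P) {T : Graph α β}
    (hT : T.IsTreeGraph) (hTG : T ≤ G) (hV : V(G).Finite) :
    (P.filter fun d => M.edge d ∈ E(T)).card + 1 ≤ V(G).ncard := by
  have := hV.fintype
  let Q := P.filter fun d => M.edge d ∈ E(T)
  let v : D → V(G) := fun d => ⟨M.vert d, (M.isLink d).left_mem⟩
  -- The coboundary map to the tree edges is surjective and kills the nonzero constant.
  let f : (V(G) → ZMod 2) →ₗ[ZMod 2] (Q → ZMod 2) :=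
    LinearMap.funLeft (ZMod 2) (ZMod 2) (fun d : Q => v d) +
      LinearMap.funLeft (ZMod 2) (ZMod 2) (fun d : Q => v (M.rev d))
  have hf : Function.Surjective f := by
    intro φ
    let ψ : D → ZMod 2 := fun d => if h : d ∈ Q then φ ⟨d, h⟩ else 0
    obtain ⟨u, hu⟩ := hP.exists_coboundary_on_tree hT hTG (φ := fun d => ψ d + ψ (M.rev d))
      fun d => by rw [M.rev_rev, add_comm]
    refine ⟨fun w => u w, funext fun d => ?_⟩
    obtain ⟨d, hd⟩ := d
    have hd' := Finset.mem_filter.mp hd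
    have h1 := hu d hd'.2
    have h2 : M.rev d ∉ Q := fun h => (hP d).mp (Finset.mem_filter.mp h).1 hd'.1
    simp only [ψ, dif_pos hd, dif_neg h2, add_zero] at h1
    rw [h1]
    rfl
  have hker : 1 ≤ Module.finrank (ZMod 2) (LinearMap.ker f) := by
    obtain ⟨x, hx⟩ := hT.1.1
    have hne : (⟨fun _ => 1, by
      ext d
      exact CharTwo.add_self_eq_zero 1⟩ : LinearMap.ker f) ≠ 0 := fun h => by
      have := congrFun (congrArg Subtype.val h) ⟨x, hTG.vertexSet_mono hx⟩
      exact one_ne_zero this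
    exact Nat.one_le_iff_ne_zero.mpr fun h =>
      hne (by have := Module.finrank_zero_iff.mp h; exact Subsingleton.elim _ _)
  have h := f.finrank_range_add_finrank_ker
  rw [LinearMap.range_eq_top.mpr hf, finrank_top, Module.finrank_fintype_fun_eq_card,
    Module.finrank_fintype_fun_eq_card, Fintype.card_coe] at h
  rw [Set.ncard_eq_toFinset_card', Set.toFinset_card]
  change Q.card + 1 ≤ _
  omega

end OrientedEmbedding

/-! ### Contractible cycles are boundaries -/

namespace OrientedEmbedding

variable {α β D : Type*} {G : Graph α β} {M : OrientedEmbedding G D}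

theorem _root_.Graph.IsCycleGraph.ncard_vertexSet {C : Graph α β} (hC : C.IsCycleGraph) :
    V(C).ncard = E(C).ncard := by
  obtain ⟨n, hn, v, e, hv, he, hV, hE, -⟩ := hC
  rw [hV, hE, ← Set.image_univ, ← Set.image_univ, Set.ncard_image_of_injective _ hv,
    Set.ncard_image_of_injective _ he]

theorem exists_dart_at (hG : G.IsConnectedGraph) [Nonempty D] {v : α} (hv : v ∈ V(G)) :
    ∃ d, M.vert d = v := by
  obtain ⟨d⟩ := ‹Nonempty D›
  obtain h | ⟨w, ⟨e, he⟩, -⟩ := (hG.2 v hv _ (M.isLink d).left_mem).cases_head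
  · exact ⟨d, h.symm⟩
  · obtain ⟨d', -, h, -⟩ := M.exists_dart_of_isLink he
    exact ⟨d', h⟩

theorem exists_faceOf_eq (hG : G.IsConnectedGraph) [Nonempty D] (f : M.Face) :
    ∃ d, M.faceOf d = f := by
  obtain q | ⟨v, hv, hv'⟩ := f
  · obtain ⟨d, rfl⟩ := Quotient.exists_rep q
    exact ⟨d, rfl⟩
  · obtain ⟨d, hd⟩ := M.exists_dart_at hG hv
    exact absurd hd (hv' d)

/-- A function of the darts that is constant along faces and along edges is constant. -/
theorem eq_of_facePerm_of_rev (hG : G.IsConnectedGraph) {k : D → ZMod 2}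
    (hk : ∀ d, k (M.facePerm d) = k d) (hr : ∀ d, k (M.rev d) = k d) (d d' : D) :
    k d = k d' := by
  obtain ⟨u, hu⟩ := M.exists_eq_comp_vert (h := k) fun d => by
    rw [← M.facePerm_rev, hk, hr]
  have : ∀ x y, Relation.ReflTransGen G.Adj x y → u x = u y := by
    intro x y h
    induction h with
    | refl => rfl
    | tail _ h ih =>
      obtain ⟨e, he⟩ := h
      obtain ⟨d, -, h1, h2⟩ := M.exists_dart_of_isLink he
      rw [ih, ← h1, ← h2, ← hu, ← hu, hr]
  rw [hu, hu]
  exact this _ _ (hG.2 _ (M.isLink d).left_mem _ (M.isLink d').left_mem)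

/-- A facial walk leaves each vertex as often as it arrives: `M.facePerm d` starts where `M.rev d`
does, so the two halves of the sum agree. -/
theorem isCycleChain_boundary [Fintype D] {k : D → ZMod 2} (hk : ∀ d, k (M.facePerm d) = k d) :
    M.IsCycleChain fun d => k d + k (M.rev d) := by
  refine ⟨fun d => by rw [M.rev_rev, add_comm], fun u => ?_⟩
  have h1 := Equiv.sum_comp M.rev fun d => k (M.rev d) * u (M.vert d)
  have h2 := Equiv.sum_comp M.facePerm fun d => k d * u (M.vert d)
  have h3 : ∀ d, M.vert (M.facePerm d) = M.vert (M.rev d) := fun d => M.vert_next _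
  simp only [M.rev_rev, hk, h3] at h1 h2
  simp only [add_mul, Finset.sum_add_distrib]
  rw [← h1, h2, CharTwo.add_self_eq_zero]

theorem ConnectedOff.mem_complement {C : Graph α β} {a b : M.Cell}
    (h : M.ConnectedOff C a b) : a ∈ M.complement C ↔ b ∈ M.complement C := by
  induction h with
  | rel x y h => exact iff_of_true h.1 h.2.1
  | refl x => rfl
  | symm x y _ ih => exact ih.symm
  | trans x y z _ _ ih1 ih2 => exact ih1.trans ih2

/-- A contractible cycle bounds a set of faces. -/
theorem IsContractible.exists_boundary [Fintype D] (hV : V(G).Finite) (hE : E(G).Finite)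
    (hG : G.IsConnectedGraph) {g : ℕ} (hg : M.HasGenus g) {C : Graph α β} (hC : C.IsCycleGraph)
    (hCG : C ≤ G) (h : M.IsContractible C) :
    ∃ k : D → ZMod 2, (∀ d, k (M.facePerm d) = k d) ∧ ∀ d, M.chain C d = k d + k (M.rev d) := by
  classical
  obtain ⟨_, ⟨a, ha, rfl⟩, hχ⟩ := h
  have hmem : ∀ {b c : M.Cell}, b ∈ M.complement C → c ∈ M.complement C → M.InFrontier b c →
      (M.ConnectedOff C a b ↔ M.ConnectedOff C a c) := fun hb hc hbc =>
    ⟨fun h => h.trans _ _ _ (.rel _ _ ⟨hb, hc, hbc⟩),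
      fun h => h.trans _ _ _ (.symm _ _ (.rel _ _ ⟨hb, hc, hbc⟩))⟩
  have hface : ∀ f : M.Face, SurfaceCell.face f ∈ M.complement C := fun _ => trivial
  let k : D → ZMod 2 := fun d =>
    if M.ConnectedOff C a (SurfaceCell.face (M.faceOf d)) then 1 else 0
  have hk : ∀ d, k (M.facePerm d) = k d := fun d => by simp only [k, M.faceOf_facePerm]
  have hoff : ∀ d, M.edge d ∉ E(C) → k d + k (M.rev d) = 0 := fun d hd => by
    have he : SurfaceCell.edge (M.edge d) ∈ M.complement C := ⟨(M.isLink d).edge_mem, hd⟩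
    have h1 := hmem he (hface (M.faceOf d)) ⟨d, rfl, rfl⟩
    have h2 := hmem he (hface (M.faceOf (M.rev d))) ⟨M.rev d, M.edge_rev d, rfl⟩
    have h3 : k d = k (M.rev d) := by simp only [k, ← h1, ← h2]
    rw [h3, CharTwo.add_self_eq_zero]
  -- The faces of the disc change membership only across edges of `C`, so their boundary is zero or
  -- `C`. If it is zero, the component is the whole complement of `C`; as `C` has equally many
  -- vertices and edges, its Euler characteristic is `2 - 2g`, an even number and not `1`.
  obtain h0 | h1 := (M.isCycleChain_boundary hk).eq_zero_or_eq_chain hC hCG hoff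
  · exfalso
    obtain ⟨n, hn, δ, -⟩ := M.exists_darts_of_isCycleGraph hC hCG
    have : Nonempty D := ⟨δ (Fin.ofNat n 0)⟩
    have hconst := M.eq_of_facePerm_of_rev hG hk fun d => by
      have := congrFun h0 d
      rw [← sub_eq_zero, CharTwo.sub_eq_add, add_comm]
      exact this
    have hcell : ∀ b ∈ M.complement C, ∃ d,
        M.ConnectedOff C a b ↔ M.ConnectedOff C a (SurfaceCell.face (M.faceOf d)) := by
      rintro (v | e | f) hb
      · obtain ⟨d, hd⟩ := M.exists_dart_at hG hb.1
        exact ⟨d, hmem hb (hface _) (Or.inl ⟨d, hd, rfl⟩)⟩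
      · obtain ⟨d, hd⟩ := M.edge_surj e hb.1
        exact ⟨d, hmem hb (hface _) ⟨d, hd, rfl⟩⟩
      · obtain ⟨d, rfl⟩ := M.exists_faceOf_eq hG f
        exact ⟨d, Iff.rfl⟩
    obtain ⟨d₀, hd₀⟩ := hcell a ha
    have hk1 : ∀ d, k d = 1 := fun d => by
      rw [hconst d d₀]
      exact if_pos (hd₀.mp (.refl a))
    have hall : ∀ b, M.ConnectedOff C a b ↔ b ∈ M.complement C := fun b => by
      refine ⟨fun h => h.mem_complement.mp ha, fun hb => ?_⟩
      obtain ⟨d, hd⟩ := hcell b hb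
      rw [hd]
      by_contra hcon
      have := hk1 d
      simp only [k, if_neg hcon] at this
      exact zero_ne_one this
    have e1 : {v : α | SurfaceCell.vertex v ∈ {b | M.ConnectedOff C a b}} = V(G) \ V(C) :=
      Set.ext fun v => hall _
    have e2 : {e : β | SurfaceCell.edge e ∈ {b | M.ConnectedOff C a b}} = E(G) \ E(C) :=
      Set.ext fun e => hall _
    have e3 : {f : M.Face | SurfaceCell.face f ∈ {b | M.ConnectedOff C a b}} = Set.univ :=
      Set.ext fun f => iff_of_true ((hall _).mpr (hface f)) trivial
    have hVC := Set.ncard_sdiff_add_ncard_of_subset hCG.vertexSet_mono hV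
    have hEC := Set.ncard_sdiff_add_ncard_of_subset (Graph.IsSubgraph.edgeSet_mono hCG) hE
    have hCC := hC.ncard_vertexSet
    rw [eulerChar, e1, e2, e3, Set.ncard_univ] at hχ
    rw [HasGenus] at hg
    omega
  · exact ⟨k, hk, fun d => (congrFun h1 d).symm⟩

theorem finite_darts (M : OrientedEmbedding G D) (hE : E(G).Finite) : Finite D := by
  have h : (M.edge ⁻¹' E(G)).Finite := by
    refine hE.preimage' fun e he => ?_
    obtain ⟨d, rfl⟩ := M.edge_surj e he
    refine (Set.toFinite {d, M.rev d}).subset fun d' hd' => ?_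
    exact (M.edge_eq_iff d d').mp (Eq.symm hd')
  exact Set.finite_univ_iff.mp (h.subset fun d _ => (M.isLink d).edge_mem)

theorem finite_face (hV : V(G).Finite) [Finite D] : Finite M.Face := by
  have : Finite {v : α // v ∈ V(G) ∧ ∀ d, M.vert d ≠ v} := (hV.subset fun _ h => h.1).to_subtype
  unfold Face
  infer_instance

theorem nonempty_face (hG : G.IsConnectedGraph) : Nonempty M.Face := by
  obtain ⟨v, hv⟩ := hG.1
  by_cases h : ∃ d, M.vert d = v
  · exact ⟨M.faceOf h.choose⟩
  · exact ⟨Sum.inr ⟨v, hv, fun d hd => h ⟨d, hd⟩⟩⟩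

end OrientedEmbedding

/-! ### The rank of the intersection matrix -/

namespace OrientedEmbedding

variable {α β D : Type*} {G : Graph α β} {M : OrientedEmbedding G D}

open Classical in
/-- The chain of a fundamental cycle, evaluated at the darts outside the tree. -/
theorem chain_fundamentalCycle {P : Finset D} (hP : M.IsOrientation P) {T C : Graph α β} {t d : D}
    (hC : G.IsFundamentalCycle T (M.edge t) C) (ht : t ∈ P) (hd : d ∈ P) (hdT : M.edge d ∉ E(T)) :
    M.chain C d = if d = t then 1 else 0 := by
  unfold chain
  congr 1
  refine propext ⟨fun h => ?_, fun h => h ▸ hC.2.2.2.1⟩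
  obtain h | h := hC.2.2.2.2 h
  · obtain h | h := (M.edge_eq_iff t d).mp h.symm
    · exact h
    · rw [h] at hd
      exact absurd ht ((hP t).mp hd)
  · exact absurd h hdT

/-- A cochain that vanishes on the fundamental cycles of a spanning tree is a coboundary. -/
theorem IsOrientation.exists_coboundary [Fintype D] {P : Finset D} (hP : M.IsOrientation P)
    {T : Graph α β} (hT : T.IsSpanningTree G) {φ : D → ZMod 2} (hφ : ∀ d, φ (M.rev d) = φ d)
    (h : ∀ t ∈ P, M.edge t ∉ E(T) → ∃ C, G.IsFundamentalCycle T (M.edge t) C ∧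
      ∑ d ∈ P, M.chain C d * φ d = 0) :
    ∃ u : α → ZMod 2, ∀ d, φ d = u (M.vert d) + u (M.vert (M.rev d)) := by
  classical
  obtain ⟨u, hu⟩ := hP.exists_coboundary_on_tree hT.2 hT.1.le hφ
  have key : ∀ t ∈ P, φ t = u (M.vert t) + u (M.vert (M.rev t)) := by
    intro t ht
    by_cases htT : M.edge t ∈ E(T)
    · exact hu t htT
    obtain ⟨C, hC, h0⟩ := h t ht htT
    -- Both `φ` and the coboundary of `u` sum to zero along `C` and agree on its tree edges, hence
    -- also on the remaining edge, that of `t`.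
    have h1 := hP.sum_mul_coboundary (M.isCycleChain_chain hC.2.2.1 hC.2.1) u
    rw [← sub_eq_zero, ← sub_eq_zero.mpr (h0.trans h1.symm), ← Finset.sum_sub_distrib,
      Finset.sum_eq_single_of_mem t ht]
    · rw [chain_fundamentalCycle hP hC ht ht htT, if_pos rfl, one_mul, one_mul]
    · intro d hd hdt
      by_cases hdT : M.edge d ∈ E(T)
      · rw [hu d hdT, sub_self]
      · rw [chain_fundamentalCycle hP hC ht hd hdT, if_neg hdt, zero_mul, zero_mul, sub_self]
  refine ⟨u, fun d => ?_⟩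
  by_cases hd : d ∈ P
  · exact key d hd
  · have := key _ ((hP d).mpr hd)
    rwa [hφ, M.rev_rev, add_comm] at this

/-- The boundaries of sets of faces form a space whose dimension is less than the number of
faces. -/
theorem finrank_boundary_lt (hG : G.IsConnectedGraph) [Finite M.Face] [Finite D] :
    Module.finrank (ZMod 2) (LinearMap.range (LinearMap.funLeft (ZMod 2) (ZMod 2) M.faceOf +
      LinearMap.funLeft (ZMod 2) (ZMod 2) fun d => M.faceOf (M.rev d))) + 1 ≤
      Nat.card M.Face := by
  have := Fintype.ofFinite M.Face
  set f := LinearMap.funLeft (ZMod 2) (ZMod 2) M.faceOf +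
    LinearMap.funLeft (ZMod 2) (ZMod 2) fun d => M.faceOf (M.rev d)
  have hker : 1 ≤ Module.finrank (ZMod 2) (LinearMap.ker f) := by
    obtain ⟨x⟩ := M.nonempty_face hG
    have hne : (⟨fun _ => 1, by
      ext d
      exact CharTwo.add_self_eq_zero 1⟩ : LinearMap.ker f) ≠ 0 := fun h => by
      have := congrFun (congrArg Subtype.val h) x
      exact one_ne_zero this
    exact Nat.one_le_iff_ne_zero.mpr fun h =>
      hne (by have := Module.finrank_zero_iff.mp h; exact Subsingleton.elim _ _)
  have h := f.finrank_range_add_finrank_ker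
  rw [Module.finrank_fintype_fun_eq_card, ← Nat.card_eq_fintype_card] at h
  omega

/-- Among the fundamental cycles of a spanning tree there are `g` disjoint pairs of cycles that
intersect an odd number of times. -/
theorem IsOrientation.exists_intersecting_fundamentalCycles [Fintype D] {P : Finset D}
    (hP : M.IsOrientation P) (hV : V(G).Finite) (hG : G.IsConnectedGraph)
    {g : ℕ} (hg : M.HasGenus g) {T : Graph α β} (hT : T.IsSpanningTree G) :
    ∃ (e : Fin (2 * g) → β) (C : Fin (2 * g) → Graph α β) (c : Fin (2 * g) → D → ZMod 2),
      Function.Injective e ∧ (∀ i, G.IsFundamentalCycle T (e i) (C i)) ∧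
      (∀ i, M.IsPotential (M.chain (C i)) (c i)) ∧
      ∀ i : Fin g, ∑ d ∈ P, M.chain (C ⟨2 * i + 1, i.two_mul_add_one_lt⟩) d *
        M.dualCochain (M.chain (C ⟨2 * i, i.two_mul_lt⟩)) (c ⟨2 * i, i.two_mul_lt⟩) d ≠ 0 := by
  classical
  let Q := P.filter fun d => M.edge d ∉ E(T)
  have hQ : ∀ t : Q, t.1 ∈ P ∧ M.edge t ∉ E(T) := fun t => Finset.mem_filter.mp t.2
  choose C hC using fun t : Q => hT.exists_isFundamentalCycle
    (e := M.edge t) ⟨(M.isLink t).edge_mem, (hQ t).2⟩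
  have hz : ∀ t, M.IsCycleChain (M.chain (C t)) := fun t =>
    M.isCycleChain_chain (hC t).2.2.1 (hC t).2.1
  choose c hc using fun t => (hz t).exists_isPotential
  let A : Matrix Q Q (ZMod 2) := fun s t =>
    ∑ d ∈ P, M.chain (C t) d * M.dualCochain (M.chain (C s)) (c s) d
  have hAs : ∀ s t, A s t = A t s := fun s t => hP.intersection_symm (hz s) (hz t) (hc s) (hc t)
  have hAd : ∀ s, A s s = 0 := fun s => hP.intersection_self (hz s) (hc s)
  have hrank : 2 * g ≤ A.rank := by
    have := M.finite_face hV
    let f := LinearMap.funLeft (ZMod 2) (ZMod 2) M.faceOf +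
      LinearMap.funLeft (ZMod 2) (ZMod 2) fun d => M.faceOf (M.rev d)
    have hf : Module.finrank (ZMod 2) (LinearMap.range f) + 1 ≤ Nat.card M.Face :=
      finrank_boundary_lt hG
    let ψ : (Q → ZMod 2) →ₗ[ZMod 2] (D → ZMod 2) :=
      Fintype.linearCombination (ZMod 2) fun t => M.chain (C t)
    have hψ : ∀ x d, ψ x d = ∑ t, x t * M.chain (C t) d := fun x d => by
      simp [ψ, Fintype.linearCombination_apply, Finset.sum_apply]
    -- The edge of `s` lies on no fundamental cycle other than `C s`, so evaluation there recovers
    -- the coefficient.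
    have hψinj : Function.Injective ψ := by
      intro x y hxy
      have key : ∀ (x : Q → ZMod 2) (s : Q), ψ x s = x s := fun x s => by
        rw [hψ, Finset.sum_eq_single_of_mem s (Finset.mem_univ s),
          chain_fundamentalCycle hP (hC s) (hQ s).1 (hQ s).1 (hQ s).2, if_pos rfl, mul_one]
        intro t _ hts
        rw [chain_fundamentalCycle hP (hC t) (hQ t).1 (hQ s).1 (hQ s).2,
          if_neg fun h => hts (Subtype.ext h.symm), mul_zero]
      funext s
      rw [← key x, ← key y, hxy]
    -- A kernel vector gives a cycle whose dual cochain vanishes on every fundamental cycle; it is a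
    -- coboundary, so by duality the cycle bounds faces.
    have hker : (LinearMap.ker A.mulVecLin).map ψ ≤ LinearMap.range f := by
      rintro _ ⟨x, hx, rfl⟩
      have hrev : ∀ d, ψ x (M.rev d) = ψ x d := fun d => by simp only [hψ, (hz _).rev]
      have hpot : M.IsPotential (ψ x) (fun d => ∑ t, x t * c t d) := fun d => by
        simp only [hψ, ← Finset.sum_add_distrib, ← mul_add]
        exact Finset.sum_congr rfl fun t _ => by rw [hc t d]
      have hdual : ∀ d, M.dualCochain (ψ x) (fun d => ∑ t, x t * c t d) d =
          ∑ t, x t * M.dualCochain (M.chain (C t)) (c t) d := fun d => by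
        simp only [dualCochain, hψ, mul_add, Finset.sum_add_distrib]
      obtain ⟨u, hu⟩ := hP.exists_coboundary hT (dualCochain_rev hrev
        (c := fun d => ∑ t, x t * c t d)) fun t ht htT => by
          let t' : Q := ⟨t, Finset.mem_filter.mpr ⟨ht, htT⟩⟩
          refine ⟨C t', hC t', ?_⟩
          have hx' : ∑ s, A t' s * x s = 0 := congrFun (LinearMap.mem_ker.mp hx) t'
          rw [← hx']
          simp only [hdual, Finset.mul_sum]
          rw [Finset.sum_comm]
          refine Finset.sum_congr rfl fun s _ => ?_
          rw [hAs, Finset.sum_mul]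
          exact Finset.sum_congr rfl fun d _ => by ring
      obtain ⟨k, hk⟩ := boundary_of_dualCochain_eq_coboundary hrev hpot hu
      exact ⟨k, funext fun d => (hk d).symm⟩
    have h1 := Submodule.finrank_mono hker
    rw [← (Submodule.equivMapOfInjective ψ hψinj _).finrank_eq] at h1
    have h2 := A.mulVecLin.finrank_range_add_finrank_ker
    rw [Module.finrank_fintype_fun_eq_card, Fintype.card_coe] at h2
    have h3 := hP.card_tree_lt hT.2 hT.1.le hV
    have h4 := Finset.card_filter_add_card_filter_not (s := P) fun d => M.edge d ∈ E(T)
    have h5 := hP.card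
    rw [HasGenus] at hg
    have h6 : A.rank = Module.finrank (ZMod 2) (LinearMap.range A.mulVecLin) := rfl
    have h7 : Q.card = (P.filter fun d => M.edge d ∉ E(T)).card := rfl
    -- `A.rank = |Q| - dim ker A`, with `|Q| ≥ |E| - |V| + 1` and `dim ker A ≤ |F| - 1`.
    omega
  obtain ⟨m, hm, hm'⟩ := A.exists_matching_of_rank hAs hAd hrank
  refine ⟨fun i => M.edge (m i), fun i => C (m i), fun i => c (m i), ?_, fun i => hC _,
    fun i => hc _, hm'⟩
  intro i j h
  obtain h | h := (M.edge_eq_iff _ _).mp h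
  · exact hm (Subtype.ext h.symm)
  · have := (hQ (m j)).1
    rw [h] at this
    exact absurd (hQ (m i)).1 ((hP _).mp this)

end OrientedEmbedding

/-! ### Conclusion -/

theorem theorem2 {α β D : Type*} (G : Graph α β) (hV : V(G).Finite) (hE : E(G).Finite)
    (hG : G.IsConnectedGraph) (M : OrientedEmbedding G D) (g : ℕ) (hg : M.HasGenus g)
    (T : Graph α β) (hT : T.IsSpanningTree G) :
    (∃ C : Fin (2 * g) → Graph α β,
      Function.Injective C ∧
      (∀ i, (∃ e ∈ E(G) \ E(T), Graph.IsFundamentalCycle G T e (C i)) ∧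
        ¬ M.IsContractible (C i)) ∧
      ∀ i : Fin g,
        (V(C ⟨2 * i, by omega⟩) ∩ V(C ⟨2 * i + 1, by omega⟩)).Nonempty) ∧
    (Nat.card M.Face = 1 →
      ∃ (e : Fin (2 * g) → β) (C : Fin (2 * g) → Graph α β),
        Function.Injective e ∧
        (∀ i, e i ∈ E(G) \ E(T) ∧ Graph.IsFundamentalCycle G T (e i) (C i)) ∧
        ∀ i : Fin g,
          (V(C ⟨2 * i, by omega⟩) ∩ V(C ⟨2 * i + 1, by omega⟩)).Nonempty) := by
  classical
  have := M.finite_darts hE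
  have := Fintype.ofFinite D
  obtain ⟨P, hP⟩ := M.exists_isOrientation
  obtain ⟨e, C, c, he, hC, hc, hodd⟩ := hP.exists_intersecting_fundamentalCycles hV hG hg hT
  -- A fundamental cycle determines its edge, the only one outside `T`.
  have hCinj : Function.Injective C := by
    intro i j hij
    have h := hij ▸ (hC i).2.2.2.1
    obtain h | h := (hC j).2.2.2.2 h
    · exact he h
    · exact absurd h (hC i).1.2
  have hcyc : ∀ i, M.IsCycleChain (M.chain (C i)) := fun i =>
    OrientedEmbedding.isCycleChain_chain (hC i).2.2.1 (hC i).2.1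
  have hmeet : ∀ i : Fin g,
      (V(C ⟨2 * i, by omega⟩) ∩ V(C ⟨2 * i + 1, by omega⟩)).Nonempty := fun i =>
    hP.inter_nonempty (hC _).2.1 (hC _).2.2.1 (hC _).2.1 (hc _) (hodd i)
  refine ⟨⟨C, hCinj, fun i => ⟨⟨e i, (hC i).1, hC i⟩, fun hcontr => ?_⟩, hmeet⟩,
    fun _ => ⟨e, C, he, fun i => ⟨(hC i).1, hC i⟩, hmeet⟩⟩
  obtain ⟨k, hk, hzk⟩ := hcontr.exists_boundary hV hE hG hg (hC i).2.2.1 (hC i).2.1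
  -- A boundary meets every cycle evenly, which contradicts the odd intersection of `C i` with its
  -- partner, `i'` being the index of their pair.
  have hzero : ∀ j, ∑ d ∈ P, M.chain (C j) d * M.dualCochain (M.chain (C i)) (c i) d = 0 :=
    fun j => hP.intersection_eq_zero_of_boundary (hcyc j) (hc i) hk hzk
  let i' : Fin g := ⟨i / 2, by omega⟩
  obtain hi | hi : i = ⟨2 * i', by omega⟩ ∨ i = ⟨2 * i' + 1, by omega⟩ := by
    simp only [Fin.ext_iff, i']
    omega
  · exact hodd i' (hi ▸ hzero _)
  · apply hodd i'
    rw [hP.intersection_symm (hcyc _) (hcyc _) (hc _) (hc _), ← hi]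
    exact hzero _
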